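/- Let $\theta<0$, let $(W_t)_{t\ge 0}$ be a standard real Brownian motion, and let $(Y_t)_{t\ge 0}$ be a process with almost surely continuous paths that solves $$dY_t=-\theta Y_t\,dt+\sqrt{-2\theta}\,dW_t,\qquad Y_0=0,$$ that is, almost surely $Y_t=-\theta\int_0^t Y_s\,ds+\sqrt{-2\theta}\,W_t$ for all $t\ge 0$. Then $$\frac1T\ln|Y_T|\longrightarrow-\theta\quad\text{almost surely as }T\to\infty.$$ Moreover, let $\gamma$ be the Euler–Mascheroni constant, $\sigma=\sqrt{\pi^2/8}$, $c=\tfrac12(\ln 2+\gamma)$, and let $g$ be the doubly exponential density $$g(x)=\frac12\sqrt{\frac{\pi}{2}}\,\exp\!\Bigl(-\tfrac14e^{z}+\tfrac12z\Bigr),\qquad z=\frac{\pi x}{\sqrt2}-\gamma .$$ For every $T>0$ the random variables $(\ln|Y_T|+T\theta)/\sigma$ and $(\ln|Y_T|+T\theta+c)/\sigma$ have everywhere differentiable distribution functions, whose derivatives are Lebesgue densities of their laws. As $T\to\infty$, for every $x\in\mathbb R$, the density at $x$ of $(\ln|Y_T|+T\theta)/\sigma$ converges to the translate $g(x+c/\sigma)$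 of $g$ (that is, to the displayed expression with $z=\pi x/\sqrt2+\ln 2$ in place of $z=\pi x/\sqrt2-\gamma$), and the density at $x$ of $(\ln|Y_T|+T\theta+c)/\sigma$ converges to $g(x)$. -/

import Mathlib

open MeasureTheory ProbabilityTheory Filter Topology
open scoped NNReal ENNReal

/-- `Y` solves the linear stochastic differential equation `dY = a Y dt + b dW`, `Y 0 = 0`, on the
time interval `[0, ∞)`. As the diffusion coefficient `b` is a constant, the Itô integral
`∫₀ᵗ b dW` is `b (W t - W 0)`. -/
structure IsLinearSDESolution {Ω : Type*} [MeasurableSpace Ω] (a b : ℝ)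
    (W Y : ℝ≥0 → Ω → ℝ) (P : Measure Ω) : Prop where
  aemeasurable : ∀ t, AEMeasurable (Y t) P
  continuous_paths : ∀ᵐ ω ∂P, Continuous (fun t => Y t ω)
  initial : ∀ᵐ ω ∂P, Y 0 ω = 0
  integral_eq : ∀ᵐ ω ∂P, ∀ t : ℝ≥0,
    Y t ω = Y 0 ω + (∫ s in (0 : ℝ)..(t : ℝ), a * Y s.toNNReal ω) + b * (W t ω - W 0 ω)

/-- The distribution function `x ↦ P (R ≤ x)` of a real random variable `R`. -/
noncomputable def distributionFunction {Ω : Type*} [MeasurableSpace Ω] (P : Measure Ω)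
    (R : Ω → ℝ) (x : ℝ) : ℝ :=
  P.real {ω | R ω ≤ x}

/-- The density `d/dx P (R ≤ x)` of a real random variable `R`. -/
noncomputable def densityFunction {Ω : Type*} [MeasurableSpace Ω] (P : Measure Ω)
    (R : Ω → ℝ) (x : ℝ) : ℝ :=
  deriv (distributionFunction P R) x

/-- `R` is a real random variable whose distribution function is everywhere differentiable and
whose law is absolutely continuous, with the derivative of the distribution function as its
Lebesgue density. -/
def HasDensityFunction {Ω : Type*} [MeasurableSpace Ω] (P : Measure Ω) (R : Ω → ℝ) : Prop :=
  AEMeasurable R P ∧ Differentiable ℝ (distributionFunction P R) ∧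
    P.map R = volume.withDensity (fun x => ENNReal.ofReal (densityFunction P R x))

/-- The scale `σ > 0` with `σ² = π² / 8`. -/
noncomputable def logScale : ℝ := √(Real.pi ^ 2 / 8)

/-- The doubly exponential density `½ √(π/2) exp (-¼ eᶻ + ½ z)`, where `z = π x / √2 - γ`. -/
noncomputable def doublyExponentialDensity (x : ℝ) : ℝ :=
  let z := Real.pi * x / √2 - Real.eulerMascheroniConstant
  1 / 2 * √(Real.pi / 2) * Real.exp (-(1 / 4) * Real.exp z + 1 / 2 * z)

/-- The constant `c = (ln 2 + γ) / 2`. -/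
noncomputable def logShift : ℝ := (Real.log 2 + Real.eulerMascheroniConstant) / 2

/-! Put `a = -θ > 0`. Multiplying the equation by `e^{-at}` gives `e^{-aT} Y_T = √(2a) ∫₀ᵀ e^{-as}
dW_s` (`IsLinearSDESolution.exp_neg_mul_eq`), where the Wiener integral of a smooth integrand is
read pathwise through integration by parts. It is centred Gaussian, and the factor `√(2a)` makes its
variance `1 - e^{-2aT}` (`IsBrownianReal.hasLaw_wienerIntegral`,
`IsLinearSDESolution.hasLaw_exp_neg_mul`).

Since `W` grows sublinearly, `e^{-aT} Y_T` converges almost surely to some `Z` with law `N(0,1)`. As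
`Z ≠ 0` almost surely, `ln|Y_T| = aT + ln|Z| + o(1)`, which gives the growth rate.

For the densities no limit theorem is needed: `ln|Y_T| - aT` is almost surely `ln|X|` with `X`
Gaussian, so its density is explicit and depends on `T` only through the variance, which tends to
`1`. The pointwise limit is the density of the rescaled logarithm of `|N(0,1)|`, and
`two_mul_gaussianPDFReal_mul_exp` identifies it with the doubly exponential density. -/

/-! ### Wiener integrals of smooth functions and their Gaussian laws. -/

/-- Riemann–Stieltjes sums of a continuous function against a continuously differentiable one,
over the partition of `[0, t]` into `n` equal parts, converge to the integral. -/
lemma tendsto_sum_mul_sub_integral {f g g' : ℝ → ℝ} (hf : Continuous f)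
    (hg : ∀ x, HasDerivAt g (g' x) x) (hg' : Continuous g') {t : ℝ} (ht : 0 ≤ t)
    {τ : ℕ → ℕ → ℝ}
    (hτ : ∀ n i : ℕ, τ n i ∈ Set.Icc ((i : ℝ) * t / n) (((i + 1 : ℕ) : ℝ) * t / n)) :
    Tendsto (fun n : ℕ => ∑ i ∈ Finset.range n,
        f (τ n i) * (g (((i + 1 : ℕ) : ℝ) * t / n) - g ((i : ℝ) * t / n)))
      atTop (𝓝 (∫ s in (0 : ℝ)..t, f s * g' s)) := by
  obtain ⟨M, hM⟩ := isCompact_Icc.exists_bound_of_continuousOn (hg'.continuousOn (s := Set.Icc 0 t))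
  have hfg : Continuous fun s => f s * g' s := hf.mul hg'
  have hM0 : 0 ≤ M := (norm_nonneg _).trans (hM 0 ⟨le_rfl, ht⟩)
  have huc := isCompact_Icc.uniformContinuousOn_of_continuous (hf.continuousOn (s := Set.Icc 0 t))
  rw [Metric.uniformContinuousOn_iff] at huc
  rw [Metric.tendsto_atTop]
  intro ε hε
  -- The total error will be `ε * (M t / (M t + 1))`; the `+ 1` makes this strictly less than `ε`
  -- and covers `M t = 0`.
  obtain ⟨δ, hδ, hfδ⟩ := huc (ε / (M * t + 1)) (by positivity)
  have hlim : Tendsto (fun n : ℕ => t / (n : ℝ)) atTop (𝓝 0) :=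
    tendsto_const_nhds.div_atTop tendsto_natCast_atTop_atTop
  obtain ⟨N, hN⟩ := eventually_atTop.1 ((hlim.eventually (gt_mem_nhds hδ)).and (eventually_gt_atTop 0))
  refine ⟨N, fun n hn => ?_⟩
  obtain ⟨hnδ, hn0⟩ := hN n hn
  have hn0' : (0 : ℝ) < n := by exact_mod_cast hn0
  have hsplit : ∫ s in (0 : ℝ)..t, f s * g' s = ∑ i ∈ Finset.range n,
      ∫ s in ((i : ℝ) * t / n)..(((i + 1 : ℕ) : ℝ) * t / n), f s * g' s := by
    rw [intervalIntegral.sum_integral_adjacent_intervals (a := fun i : ℕ => (i : ℝ) * t / n)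
      (fun i _ => hfg.intervalIntegrable _ _)]
    congr 1
    · simp
    · field_simp
  rw [hsplit, dist_eq_norm, ← Finset.sum_sub_distrib]
  have hterm : ∀ i ∈ Finset.range n, ‖f (τ n i) * (g (((i + 1 : ℕ) : ℝ) * t / n) - g ((i : ℝ) * t / n))
      - ∫ s in ((i : ℝ) * t / n)..(((i + 1 : ℕ) : ℝ) * t / n), f s * g' s‖
      ≤ ε / (M * t + 1) * M * (t / n) := by
    intro i hi
    have hi' : ((i + 1 : ℕ) : ℝ) ≤ n := by exact_mod_cast Finset.mem_range.1 hi
    have hstep : ((i + 1 : ℕ) : ℝ) * t / n - (i : ℝ) * t / n = t / n := by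
      push_cast; ring
    have hle : (i : ℝ) * t / n ≤ ((i + 1 : ℕ) : ℝ) * t / n := by
      have : 0 ≤ t / n := by positivity
      linarith
    have hupper : ((i + 1 : ℕ) : ℝ) * t / n ≤ t := by
      rw [div_le_iff₀ hn0', mul_comm t]; gcongr
    have hlower : 0 ≤ (i : ℝ) * t / n := by positivity
    rw [← intervalIntegral.integral_eq_sub_of_hasDerivAt (fun x _ => hg x)
      (hg'.intervalIntegrable _ _), ← intervalIntegral.integral_const_mul,
      ← intervalIntegral.integral_sub (Continuous.intervalIntegrable (by fun_prop) _ _)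
        (hfg.intervalIntegrable _ _)]
    refine (intervalIntegral.norm_integral_le_of_norm_le_const
      (C := ε / (M * t + 1) * M) fun s hs => ?_).trans_eq ?_
    · rw [Set.uIoc_of_le hle] at hs
      obtain ⟨h1, h2⟩ := hτ n i
      have hs0 : s ∈ Set.Icc 0 t := ⟨by linarith [hs.1], by linarith [hs.2]⟩
      have hd := hfδ (τ n i) ⟨by linarith, by linarith⟩ s hs0
        (by rw [Real.dist_eq, abs_lt]; constructor <;> linarith [hs.1, hs.2])
      rw [← sub_mul, norm_mul]
      exact mul_le_mul (by rw [← dist_eq_norm]; exact hd.le) (hM s hs0) (norm_nonneg _)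
        (by positivity)
    · rw [hstep, abs_of_nonneg (by positivity)]
  refine (norm_sum_le_of_le _ hterm).trans_lt ?_
  rw [Finset.sum_const, Finset.card_range, nsmul_eq_mul]
  calc (n : ℝ) * (ε / (M * t + 1) * M * (t / n)) = ε * (M * t / (M * t + 1)) := by
        field_simp
    _ < ε * 1 := by
        gcongr
        rw [div_lt_one (by positivity)]
        linarith
    _ = ε := mul_one ε

/-- An almost sure limit of centred Gaussian variables whose variances converge is Gaussian. -/
lemma hasLaw_gaussianReal_of_tendsto {Ω : Type*} [MeasurableSpace Ω] {P : Measure Ω}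
    [IsProbabilityMeasure P] {S : ℕ → Ω → ℝ} {X : Ω → ℝ} {v : ℕ → ℝ≥0} {w : ℝ≥0}
    (hS : ∀ n, HasLaw (S n) (gaussianReal 0 (v n)) P)
    (hlim : ∀ᵐ ω ∂P, Tendsto (fun n => S n ω) atTop (𝓝 (X ω)))
    (hv : Tendsto v atTop (𝓝 w)) : HasLaw X (gaussianReal 0 w) P := by
  have hX : AEMeasurable X P := aemeasurable_of_tendsto_metrizable_ae atTop
    (fun n => (hS n).aemeasurable) hlim
  refine ⟨hX, ?_⟩
  have := Measure.isProbabilityMeasure_map hX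
  -- Dominated convergence passes characteristic functions to the limit, and the Gaussian ones are
  -- continuous in the variance, including at variance `0`.
  refine Measure.ext_of_charFun (funext fun u => ?_)
  have hchar {Z : Ω → ℝ} (hZ : AEMeasurable Z P) :
      charFun (P.map Z) u = ∫ ω, Complex.exp (u * Z ω * Complex.I) ∂P := by
    rw [charFun_apply_real, integral_map hZ (by fun_prop)]
  have h1 : Tendsto (fun n => charFun (P.map (S n)) u) atTop (𝓝 (charFun (P.map X) u)) := by
    simp_rw [hchar hX, fun n => hchar (hS n).aemeasurable]
    refine tendsto_integral_of_dominated_convergence (fun _ => 1) (fun n => ?_)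
      (integrable_const _) (fun n => ?_) ?_
    · have := (hS n).aemeasurable
      exact AEMeasurable.aestronglyMeasurable (by fun_prop)
    · refine Eventually.of_forall fun ω => le_of_eq ?_
      exact_mod_cast Complex.norm_exp_ofReal_mul_I (u * S n ω)
    · filter_upwards [hlim] with ω hω
      have hc : Continuous fun y : ℝ => Complex.exp (u * y * Complex.I) := by fun_prop
      exact (hc.tendsto _).comp hω
  refine tendsto_nhds_unique h1 ?_
  simp_rw [(hS _).map_eq, charFun_gaussianReal]
  have hc : Continuous fun z : ℝ≥0 =>
      Complex.exp ((u : ℂ) * ((0 : ℝ) : ℂ) * Complex.I - (((z : ℝ≥0) : ℝ) : ℂ) * u ^ 2 / 2) := by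
    fun_prop
  exact (hc.tendsto w).comp hv

lemma hasLaw_gaussianReal_sum_of_iIndepFun {Ω : Type*} [MeasurableSpace Ω] {P : Measure Ω}
    [IsProbabilityMeasure P] {ι : Type*} {X : ι → Ω → ℝ} {v : ι → ℝ≥0}
    (hX : ∀ i, HasLaw (X i) (gaussianReal 0 (v i)) P) (hind : iIndepFun X P) (s : Finset ι) :
    HasLaw (fun ω => ∑ i ∈ s, X i ω) (gaussianReal 0 (∑ i ∈ s, v i)) P := by
  classical
  have hm : AEMeasurable (fun ω => ∑ i ∈ s, X i ω) P :=
    Finset.aemeasurable_fun_sum _ fun i _ => (hX i).aemeasurable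
  refine ⟨hm, ?_⟩
  induction s using Finset.induction_on with
  | empty => simp [Measure.map_const]
  | insert i s hi ih =>
    have hs : AEMeasurable (fun ω => ∑ j ∈ s, X j ω) P :=
      Finset.aemeasurable_fun_sum _ fun i _ => (hX i).aemeasurable
    have hindep : IndepFun (X i) (∑ j ∈ s, X j) P :=
      (hind.indepFun_finsetSum_of_notMem₀ (fun i => (hX i).aemeasurable) hi).symm
    have hs' : P.map (∑ j ∈ s, X j) = gaussianReal 0 (∑ j ∈ s, v j) := by
      rw [← ih hs]; congr 1; ext ω; simp
    have := gaussianReal_add_gaussianReal_of_indepFun hindep (hX i).map_eq hs'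
    rw [Finset.sum_insert hi]
    rw [add_zero] at this
    rw [← this]; congr 1; ext ω; simp [Finset.sum_insert hi]

/-- Abel summation moves the increments from the Brownian path, which is only continuous, onto the
smooth integrand. -/
lemma sum_range_mul_sub_by_parts (x w : ℕ → ℝ) (n : ℕ) :
    ∑ i ∈ Finset.range n, x i * (w (i + 1) - w i) =
      x n * w n - x 0 * w 0 - ∑ i ∈ Finset.range n, w (i + 1) * (x (i + 1) - x i) := by
  induction n with
  | zero => simp
  | succ n ih => rw [Finset.sum_range_succ, Finset.sum_range_succ, ih]; ring

/-- The Wiener integral of a continuously differentiable function `φ` on `[0, t]`, defined through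
integration by parts, is centred Gaussian with variance `∫₀ᵗ φ²`. -/
lemma IsBrownianReal.hasLaw_wienerIntegral {Ω : Type*} [MeasurableSpace Ω] {P : Measure Ω}
    [IsProbabilityMeasure P] {W : ℝ≥0 → Ω → ℝ} (hW : IsBrownianReal W P) {φ φ' : ℝ → ℝ}
    (hφ : ∀ x, HasDerivAt φ (φ' x) x) (hφ' : Continuous φ') (t : ℝ≥0) :
    HasLaw (fun ω => φ t * W t ω - ∫ s in (0 : ℝ)..t, W s.toNNReal ω * φ' s)
      (gaussianReal 0 (∫ s in (0 : ℝ)..t, φ s ^ 2).toNNReal) P := by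
  have hφc : Continuous φ := continuous_iff_continuousAt.2 fun x => (hφ x).continuousAt
  let r : ℕ → ℕ → ℝ≥0 := fun n i => (i : ℝ≥0) * t / n
  have hr (n i : ℕ) : ((r n i : ℝ≥0) : ℝ) = (i : ℝ) * t / n := by simp [r]
  have hrmono (n : ℕ) : Monotone (r n) := by
    intro i j hij
    simp only [r]
    gcongr
  have hmem_left (n i : ℕ) : (i : ℝ) * t / n ∈
      Set.Icc ((i : ℝ) * t / n) (((i + 1 : ℕ) : ℝ) * t / n) := by
    refine ⟨le_rfl, ?_⟩
    rw [← hr, ← hr]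
    exact_mod_cast hrmono n i.le_succ
  have hmem_right (n i : ℕ) : ((i + 1 : ℕ) : ℝ) * t / n ∈
      Set.Icc ((i : ℝ) * t / n) (((i + 1 : ℕ) : ℝ) * t / n) := by
    refine ⟨?_, le_rfl⟩
    rw [← hr, ← hr]
    exact_mod_cast hrmono n i.le_succ
  let v : ℕ → ℕ → ℝ≥0 := fun n i =>
    NNReal.mk (φ (r n i) ^ 2) (sq_nonneg _) * nndist (r n (i + 1) : ℝ) (r n i : ℝ)
  have hv (n i : ℕ) : (v n i : ℝ) =
      φ ((i : ℝ) * t / n) ^ 2 * (((i + 1 : ℕ) : ℝ) * t / n - (i : ℝ) * t / n) := by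
    have h := (hmem_left n i).2
    simp only [v, NNReal.coe_mul, NNReal.coe_mk, coe_nndist, hr, Real.dist_eq]
    rw [abs_of_nonneg (by linarith)]
  refine hasLaw_gaussianReal_of_tendsto
    (S := fun n ω => ∑ i ∈ Finset.range n, φ (r n i) * (W (r n (i + 1)) ω - W (r n i) ω))
    (v := fun n => ∑ i ∈ Finset.range n, v n i) (fun n => ?_) ?_ ?_
  · refine hasLaw_gaussianReal_sum_of_iIndepFun (fun i => ?_) ?_ _
    · have h := gaussianReal_const_mul (hW.hasLaw_sub (r n (i + 1)) (r n i)) (φ (r n i))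
      rw [mul_zero] at h
      exact h
    · exact (hW.hasIndepIncrements.nat (hrmono n)).comp (fun i x => φ (r n i) * x)
        (fun i => by fun_prop)
  -- After summation by parts `W` is the continuous integrand and `φ` the smooth integrator; `W` is
  -- then sampled at right endpoints, hence `hmem_right`.
  · filter_upwards [hW.cont, hW.eval_zero_ae_eq_zero] with ω hω hω0
    have hwc : Continuous fun s : ℝ => W s.toNNReal ω := hω.comp continuous_real_toNNReal
    have h := tendsto_sum_mul_sub_integral hwc hφ hφ' t.2 hmem_right
    have h2 := h.const_sub (φ t * W t ω)
    refine h2.congr' ?_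
    filter_upwards [eventually_gt_atTop 0] with n hn
    have hn' : (n : ℝ≥0) ≠ 0 := by exact_mod_cast hn.ne'
    have hrn : r n n = t := by simp only [r]; field_simp
    rw [sum_range_mul_sub_by_parts (fun i => φ (r n i)) (fun i => W (r n i) ω), hrn,
      show r n 0 = 0 by simp [r], hω0]
    simp only [mul_zero, sub_zero]
    congr 1
    refine Finset.sum_congr rfl fun i _ => ?_
    change W (((i + 1 : ℕ) : ℝ) * t / n).toNNReal ω *
      (φ (((i + 1 : ℕ) : ℝ) * t / n) - φ ((i : ℝ) * t / n)) = _
    rw [← hr, ← hr, Real.toNNReal_coe]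
  -- The variances are the left Riemann sums of `φ²`.
  · have h := tendsto_sum_mul_sub_integral (hφc.pow 2) hasDerivAt_id continuous_const t.2 hmem_left
    have h2 := (continuous_real_toNNReal.tendsto _).comp h
    simp only [mul_one] at h2
    refine h2.congr fun n => ?_
    apply NNReal.eq
    rw [Function.comp_apply, NNReal.coe_sum, Real.coe_toNNReal]
    · exact Finset.sum_congr rfl fun i _ => (hv n i).symm
    · exact Finset.sum_nonneg fun i _ => (hv n i).symm ▸ (v n i).2

/-! ### Sublinear growth of Brownian motion by time inversion. -/

/-- The restrictions of two pre-Brownian motions to countably many times have the same law. -/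
lemma IsPreBrownianReal.map_comp_eq_map_comp {Ω ι : Type*} [MeasurableSpace Ω] [Countable ι]
    {P : Measure Ω} [IsProbabilityMeasure P] {B C : ℝ≥0 → Ω → ℝ} (hB : IsPreBrownianReal B P)
    (hC : IsPreBrownianReal C P) (e : ι → ℝ≥0) :
    P.map (fun ω i => B (e i) ω) = P.map (fun ω i => C (e i) ω) := by
  classical
  rw [map_eq_iff_forall_finset_map_restrict_eq (X := fun i => B (e i)) (Y := fun i => C (e i))
    (aemeasurable_pi_lambda _ fun i => hB.aemeasurable _)
    (aemeasurable_pi_lambda _ fun i => hC.aemeasurable _)]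
  intro I
  let ρ : (I.image e → ℝ) → (I → ℝ) := fun x i => x ⟨e i, Finset.mem_image_of_mem e i.2⟩
  have hρ : Measurable ρ := by fun_prop
  have key {X : ℝ≥0 → Ω → ℝ} (hX : IsPreBrownianReal X P) :
      P.map (fun ω => I.restrict fun i => X (e i) ω) =
        (BrownianReal.projectiveFamily (I.image e)).map ρ := by
    rw [← (hX.hasLaw (I.image e)).map_eq,
      AEMeasurable.map_map_of_aemeasurable hρ.aemeasurable (hX.hasLaw _).aemeasurable]
    rfl
  rw [key hB, key hC]

/-- Brownian motion grows sublinearly. -/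
lemma IsBrownianReal.tendsto_div_atTop {Ω : Type*} [MeasurableSpace Ω] {P : Measure Ω}
    [IsProbabilityMeasure P] {W : ℝ≥0 → Ω → ℝ} (hW : IsBrownianReal W P) :
    ∀ᵐ ω ∂P, Tendsto (fun t : ℝ≥0 => W t ω / t) atTop (𝓝 0) := by
  let e := TopologicalSpace.denseSeq ℝ≥0
  -- Convergence to `0` at time `0`, tested only along a dense sequence of times: a measurable
  -- condition on countably many coordinates, so equality of laws carries it from `W` to its time
  -- inversion.
  let p : (ℕ → ℝ) → Prop := fun f => ∀ k : ℕ, ∃ n : ℕ, ∀ q : ℕ,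
    e q < 1 / ((n : ℝ≥0) + 1) → |f q| ≤ 1 / ((k : ℝ) + 1)
  have hp : MeasurableSet {f | p f} := by
    refine measurableSet_setOfPred.2 ?_
    refine Measurable.forall fun k => Measurable.exists fun n => Measurable.forall fun q =>
      measurable_const.imp ?_
    exact measurableSet_setOfPred.1 (measurableSet_le (by fun_prop) measurable_const)
  have hinv := hW.toIsPreBrownianReal.inv
  have hlaw := IsPreBrownianReal.map_comp_eq_map_comp hW.toIsPreBrownianReal hinv e
  have hW0 : ∀ᵐ ω ∂P, p fun q => W (e q) ω := by
    filter_upwards [hW.tendsto_nhds_zero] with ω hω k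
    have h1 := hω.eventually (Metric.closedBall_mem_nhds 0 (ε := 1 / ((k : ℝ) + 1)) (by positivity))
    obtain ⟨δ, hδ, h⟩ := Metric.eventually_nhds_iff.1 h1
    obtain ⟨n, hn⟩ := exists_nat_one_div_lt hδ
    refine ⟨n, fun q hq => ?_⟩
    have := @h (e q) (by
      rw [NNReal.dist_eq, NNReal.coe_zero, sub_zero, NNReal.abs_eq]
      refine lt_trans ?_ hn
      exact_mod_cast hq)
    simpa using this
  have hinv0 : ∀ᵐ ω ∂P, p fun q => e q * W (1 / e q) ω := by
    rw [← ae_map_iff (p := p) (aemeasurable_pi_lambda _ fun i => hW.aemeasurable _) hp, hlaw,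
      ae_map_iff (aemeasurable_pi_lambda _ fun i => hinv.aemeasurable _) hp] at hW0
    exact hW0
  filter_upwards [hinv0, hW.cont] with ω hω hc
  rw [Metric.tendsto_atTop]
  intro ε hε
  obtain ⟨k, hk⟩ := exists_nat_one_div_lt hε
  obtain ⟨n, hn⟩ := hω k
  -- With `n + 2` the bound `1 / t < 1 / (n + 1)` is strict.
  refine ⟨n + 2, fun t ht => ?_⟩
  have ht0 : 0 < t := lt_of_lt_of_le (by positivity) ht
  rw [dist_zero_right]
  refine lt_of_le_of_lt ?_ hk
  -- A violation at `t` is one of `s W(1/s)` at `s = 1/t`; by continuity it persists on an open set,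
  -- which the dense sequence meets.
  by_contra! hcon
  have hcont : ContinuousOn (fun s : ℝ≥0 => |(s : ℝ) * W (1 / s) ω|) (Set.Ioo 0 (1 / ((n : ℝ≥0) + 1))) := by
    have h1 : ContinuousOn (fun s : ℝ≥0 => 1 / s) (Set.Ioo 0 (1 / ((n : ℝ≥0) + 1))) :=
      continuousOn_const.div continuousOn_id fun s hs => hs.1.ne'
    exact ((NNReal.continuous_coe.continuousOn).mul (hc.comp_continuousOn h1)).abs
  have hopen := hcont.isOpen_inter_preimage isOpen_Ioo (isOpen_Ioi (a := 1 / ((k : ℝ) + 1)))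
  obtain ⟨q, hq⟩ := (TopologicalSpace.denseRange_denseSeq ℝ≥0).exists_mem_open hopen
    ⟨1 / t, ⟨by positivity, one_div_lt_one_div_of_lt (by positivity)
      (lt_of_lt_of_le (by gcongr; norm_num) ht)⟩, by
        simpa [div_eq_inv_mul] using hcon⟩
  exact absurd (hn q hq.1.2) (not_le.2 hq.2)

/-! ### Variation of constants and pathwise convergence. -/

/-- Variation of constants for the integral equation `y = ∫ a y + b w`. -/
lemma exp_neg_mul_eq_of_integral_eq {a b : ℝ} {y w : ℝ → ℝ} (hy : Continuous y)
    (h : ∀ t, 0 ≤ t → y t = (∫ s in (0 : ℝ)..t, a * y s) + b * w t) {t : ℝ} (ht : 0 ≤ t) :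
    Real.exp (-a * t) * y t = b * (Real.exp (-a * t) * w t -
      ∫ s in (0 : ℝ)..t, w s * (-a * Real.exp (-a * s))) := by
  have hZ (s : ℝ) : HasDerivAt (fun t => ∫ s in (0 : ℝ)..t, a * y s) (a * y s) s :=
    (continuous_const.mul hy).integral_hasStrictDerivAt 0 s |>.hasDerivAt
  have hE (s : ℝ) : HasDerivAt (fun s => Real.exp (-a * s)) (-a * Real.exp (-a * s)) s := by
    simpa [mul_comm] using ((hasDerivAt_id s).const_mul (-a)).exp
  have hZc : Continuous fun t => ∫ s in (0 : ℝ)..t, a * y s :=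
    continuous_iff_continuousAt.2 fun s => (hZ s).continuousAt
  -- The product rule is applied to the drift integral, which is differentiable although `y` need
  -- not be. Substituting `y = ∫ a y + b w` then cancels everything but the `w` term.
  have hFTC := intervalIntegral.integral_eq_sub_of_hasDerivAt (a := 0) (b := t)
    (fun s _ => (hE s).mul (hZ s)) (Continuous.intervalIntegrable (by fun_prop) _ _)
  have hcongr : ∫ s in (0 : ℝ)..t, (-a * Real.exp (-a * s) * (∫ u in (0 : ℝ)..s, a * y u) +
      Real.exp (-a * s) * (a * y s)) =
      ∫ s in (0 : ℝ)..t, -b * (w s * (-a * Real.exp (-a * s))) := by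
    refine intervalIntegral.integral_congr fun s hs => ?_
    rw [Set.uIcc_of_le ht] at hs
    have := h s hs.1
    rw [this]; ring
  rw [hcongr, intervalIntegral.integral_const_mul] at hFTC
  simp only [Pi.mul_apply, intervalIntegral.integral_same, mul_zero, sub_zero] at hFTC
  rw [h t ht, mul_add, ← hFTC]; ring

/-- `∫₀ᵗ w dφ`, with `φ(s) = e^{-as}`, converges for a path `w` of sublinear growth. -/
lemma tendsto_exp_neg_mul_sub_integral {a : ℝ} (ha : 0 < a) {w : ℝ → ℝ} (hw : Continuous w)
    (hlim : Tendsto (fun t => w t / t) atTop (𝓝 0)) :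
    Tendsto (fun t => Real.exp (-a * t) * w t -
        ∫ s in (0 : ℝ)..t, w s * (-a * Real.exp (-a * s)))
      atTop (𝓝 (-∫ s in Set.Ioi (0 : ℝ), w s * (-a * Real.exp (-a * s)))) := by
  have ho1 : w =o[atTop] fun t : ℝ => t :=
    Asymptotics.isLittleO_iff_tendsto' (by
      filter_upwards [eventually_ne_atTop 0] with t ht h using absurd h ht) |>.2 hlim
  -- Half of the exponential decay absorbs `w`; the other half kills the boundary term and makes the
  -- integrand integrable.
  have ho : w =o[atTop] fun t => Real.exp (a / 2 * t) := by
    have := isLittleO_pow_exp_pos_mul_atTop 1 (half_pos ha)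
    simp only [pow_one] at this
    exact ho1.trans this
  have hexp (t : ℝ) : Real.exp (a / 2 * t) * Real.exp (-a * t) = Real.exp (-(a / 2) * t) := by
    rw [← Real.exp_add]; congr 1; ring
  have ho2 : (fun t => w t * Real.exp (-a * t)) =o[atTop] fun t => Real.exp (-(a / 2) * t) := by
    simp_rw [← hexp]
    exact ho.mul_isBigO (Asymptotics.isBigO_refl _ _)
  have hzero : Tendsto (fun t => Real.exp (-a * t) * w t) atTop (𝓝 0) := by
    have h0 : Tendsto (fun t => Real.exp (-(a / 2) * t)) atTop (𝓝 0) :=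
      Real.tendsto_exp_atBot.comp (tendsto_id.const_mul_atTop_of_neg (by linarith))
    simpa only [mul_comm] using ho2.isBigO.trans_tendsto h0
  have hint : IntegrableOn (fun s => w s * (-a * Real.exp (-a * s))) (Set.Ioi 0) := by
    refine integrable_of_isBigO_exp_neg (half_pos ha) (by fun_prop) ?_
    have := ho2.isBigO.const_mul_left (-a)
    refine this.congr_left fun s => by ring
  simpa using hzero.sub (intervalIntegral_tendsto_integral_Ioi 0 hint tendsto_id)

/-! ### Densities of logarithms of Gaussian variables. -/

/-- A random variable whose distribution function has a continuous derivative has that derivative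
as a density. -/
lemma hasDensityFunction_of_hasDerivAt {Ω : Type*} [MeasurableSpace Ω] {P : Measure Ω}
    [IsProbabilityMeasure P] {R : Ω → ℝ} (hR : AEMeasurable R P) {f : ℝ → ℝ}
    (hF : ∀ x, HasDerivAt (distributionFunction P R) (f x) x) (hf : Continuous f)
    (hf0 : ∀ x, 0 ≤ f x) : HasDensityFunction P R := by
  have hdens : densityFunction P R = f := funext fun x => (hF x).deriv
  refine ⟨hR, fun x => (hF x).differentiableAt, ?_⟩
  rw [hdens]
  have := Measure.isProbabilityMeasure_map hR
  have hcdf (x : ℝ) : cdf (P.map R) x = distributionFunction P R x := by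
    rw [cdf_eq_real, map_measureReal_apply_of_aemeasurable hR measurableSet_Iic]
    rfl
  refine Measure.ext_of_Ioc _ _ fun a b hab => ?_
  rw [← measure_cdf (P.map R), StieltjesFunction.measure_Ioc, hcdf, hcdf,
    withDensity_apply _ measurableSet_Ioc, ← ofReal_integral_eq_lintegral_ofReal
      (hf.integrableOn_Ioc) (Eventually.of_forall hf0),
    ← intervalIntegral.integral_of_le hab.le,
    intervalIntegral.integral_eq_sub_of_hasDerivAt (fun x _ => hF x) (hf.intervalIntegrable _ _)]

lemma continuous_gaussianPDFReal (m : ℝ) (v : ℝ≥0) : Continuous (gaussianPDFReal m v) := by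
  rw [gaussianPDFReal_def]
  fun_prop

/-- The distribution function of `(ln |X| + d) / s` for a centred Gaussian variable `X`. -/
lemma hasDerivAt_distributionFunction_log_abs {Ω : Type*} [MeasurableSpace Ω] {P : Measure Ω}
    {X : Ω → ℝ} {v : ℝ≥0} (hX : HasLaw X (gaussianReal 0 v) P)
    (hv : v ≠ 0) {s : ℝ} (hs : 0 < s) (d x : ℝ) :
    HasDerivAt (distributionFunction P fun ω => (Real.log |X ω| + d) / s)
      (2 * gaussianPDFReal 0 v (Real.exp (s * x - d)) * (Real.exp (s * x - d) * s)) x := by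
  have hc := continuous_gaussianPDFReal 0 v
  have hF : (distributionFunction P fun ω => (Real.log |X ω| + d) / s) = fun x =>
      (∫ y in (0 : ℝ)..Real.exp (s * x - d), gaussianPDFReal 0 v y) -
        ∫ y in (0 : ℝ)..-Real.exp (s * x - d), gaussianPDFReal 0 v y := by
    funext x
    set u := Real.exp (s * x - d) with hu
    have hu0 : 0 < u := Real.exp_pos _
    have h1 : distributionFunction P (fun ω => (Real.log |X ω| + d) / s) x =
        (gaussianReal 0 v).real {z | (Real.log |z| + d) / s ≤ x} :=
      hX.measureReal_eq (p := fun z => (Real.log |z| + d) / s ≤ x)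
        (measurableSet_le (by fun_prop) measurable_const)
    have := nullSingletonClass_gaussianReal (μ := 0) hv
    have h2 : ({z | (Real.log |z| + d) / s ≤ x} : Set ℝ) =ᵐ[gaussianReal 0 v] Set.Ioc (-u) u := by
      -- Two null points are discarded: `0`, where `Real.log` takes its default value `0`, and `-u`,
      -- to pass from a closed to a half-open interval.
      have h0 : ∀ᵐ z ∂(gaussianReal 0 v), z ∉ ({0, -u} : Set ℝ) :=
        measure_eq_zero_iff_ae_notMem.1 ((Set.toFinite _).measure_zero _)
      filter_upwards [h0] with z hz
      simp only [Set.mem_insert_iff, Set.mem_singleton_iff, not_or] at hz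
      refine propext ?_
      change (Real.log |z| + d) / s ≤ x ↔ -u < z ∧ z ≤ u
      rw [div_le_iff₀ hs, ← le_sub_iff_add_le, Real.log_le_iff_le_exp (abs_pos.2 hz.1),
        mul_comm x, ← hu, abs_le]
      exact and_congr_left fun _ => ⟨fun h => lt_of_le_of_ne h (Ne.symm hz.2), le_of_lt⟩
    rw [h1, measureReal_congr h2, measureReal_def, gaussianReal_apply_eq_integral _ hv,
      ENNReal.toReal_ofReal (integral_nonneg fun _ => gaussianPDFReal_nonneg _ _ _),
      ← intervalIntegral.integral_of_le (by linarith),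
      intervalIntegral.integral_interval_sub_left (hc.intervalIntegrable _ _)
        (hc.intervalIntegrable _ _)]
  rw [hF]
  have hE : HasDerivAt (fun x => Real.exp (s * x - d)) (Real.exp (s * x - d) * s) x := by
    simpa using (((hasDerivAt_id x).const_mul s).sub_const d).exp
  have hG (y : ℝ) : HasDerivAt (fun u => ∫ y in (0 : ℝ)..u, gaussianPDFReal 0 v y)
      (gaussianPDFReal 0 v y) y := (hc.integral_hasStrictDerivAt 0 y).hasDerivAt
  have heven : gaussianPDFReal 0 v (-Real.exp (s * x - d)) =
      gaussianPDFReal 0 v (Real.exp (s * x - d)) := by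
    simp [gaussianPDFReal]
  refine (((hG _).comp x hE).sub ((hG _).comp x hE.neg)).congr_deriv ?_
  rw [Pi.neg_apply, heven]; ring

lemma logScale_eq : logScale = Real.pi / (2 * √2) := by
  rw [logScale, Real.sqrt_eq_iff_eq_sq (by positivity) (by positivity), div_pow, mul_pow,
    Real.sq_sqrt (by norm_num)]
  norm_num

lemma logScale_pos : 0 < logScale := by rw [logScale_eq]; positivity

/-- With `w = σx - d`, the relations `π/√2 = 2σ` and `2c = ln 2 + γ` give `z = 2w + ln 2`, so `¼ eᶻ
= ½ e^{2w}` and `e^{z/2} = √2 e^w`; only constants remain to be matched. -/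
lemma two_mul_gaussianPDFReal_mul_exp (x d : ℝ) :
    2 * gaussianPDFReal 0 1 (Real.exp (logScale * x - d)) *
      (Real.exp (logScale * x - d) * logScale) =
      doublyExponentialDensity (x + (logShift - d) / logScale) := by
  have hs := logScale_pos
  set w := logScale * x - d with hw
  have hz : Real.pi * (x + (logShift - d) / logScale) / √2 - Real.eulerMascheroniConstant =
      2 * w + Real.log 2 := by
    have h1 : Real.pi / √2 = 2 * logScale := by rw [logScale_eq]; field_simp
    have h2 : Real.pi * (x + (logShift - d) / logScale) / √2 =
        2 * logScale * (x + (logShift - d) / logScale) := by rw [← h1]; ring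
    rw [h2, hw, logShift]
    field_simp
    ring
  have h2 : Real.exp (1 / 2 * Real.log 2) = √2 := by
    rw [Real.sqrt_eq_rpow, Real.rpow_def_of_pos (by norm_num), mul_comm]
  have hexp : Real.exp (-(1 / 4) * Real.exp (2 * w + Real.log 2) + 1 / 2 * (2 * w + Real.log 2)) =
      Real.exp (-(Real.exp w) ^ 2 / 2) * Real.exp w * √2 := by
    rw [← h2, ← Real.exp_add, ← Real.exp_add]
    congr 1
    rw [Real.exp_add, Real.exp_log (by norm_num), two_mul w, Real.exp_add]
    ring
  simp only [doublyExponentialDensity]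
  rw [hz, hexp, gaussianPDFReal, logScale_eq]
  simp only [NNReal.coe_one, mul_one, sub_zero]
  rw [Real.sqrt_mul (by norm_num), Real.sqrt_div Real.pi_pos.le]
  have h3 : Real.pi = √Real.pi * √Real.pi := (Real.mul_self_sqrt Real.pi_pos.le).symm
  have h4 : √2 * √2 = (2 : ℝ) := Real.mul_self_sqrt (by norm_num)
  have h5 : 0 < √Real.pi := Real.sqrt_pos.2 Real.pi_pos
  have h6 : 0 < √(2 : ℝ) := by positivity
  have h7 : 2 * (√2 * √Real.pi)⁻¹ * (Real.pi / (2 * √2)) = 1 / 2 * (√Real.pi / √2) * √2 := by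
    nth_rewrite 2 [h3]
    field_simp
    rw [sq, h4]
  linear_combination (Real.exp (-(Real.exp w) ^ 2 / 2) * Real.exp w) * h7

lemma ae_ne_zero_of_hasLaw_gaussianReal {Ω : Type*} [MeasurableSpace Ω] {P : Measure Ω}
    {X : Ω → ℝ} {v : ℝ≥0}
    (hX : HasLaw X (gaussianReal 0 v) P) (hv : v ≠ 0) : ∀ᵐ ω ∂P, X ω ≠ 0 := by
  have := nullSingletonClass_gaussianReal (μ := 0) hv
  refine (hX.ae_iff (p := fun x => x ≠ 0) ?_).2
    (measure_eq_zero_iff_ae_notMem.1 (measure_singleton 0))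
  exact measurableSet_setOfPred.1 (measurableSet_singleton (0 : ℝ)).compl

lemma log_abs_exp_neg_mul (a t : ℝ) {y : ℝ} (hy : Real.exp (-a * t) * y ≠ 0) :
    Real.log |Real.exp (-a * t) * y| = Real.log |y| - t * a := by
  rw [abs_mul, Real.abs_exp, Real.log_mul (Real.exp_pos _).ne'
    (abs_ne_zero.2 (right_ne_zero_of_mul hy)), Real.log_exp]
  ring

lemma one_sub_exp_toNNReal_ne_zero {a : ℝ} (ha : 0 < a) {T : ℝ≥0} (hT : 0 < T) :
    (1 - Real.exp (-(2 * a) * T)).toNNReal ≠ 0 := by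
  have : (0 : ℝ) < T := hT
  refine (Real.toNNReal_pos.2 (sub_pos.2 (Real.exp_lt_one_iff.2 ?_))).ne'
  nlinarith [mul_pos ha this]

/-! ### The discounted solution, its limit, and the asymptotics. -/

/-- The discounted solution `e^{-aT} Y_T` as a Wiener integral. -/
lemma IsLinearSDESolution.exp_neg_mul_eq {Ω : Type*} [MeasurableSpace Ω] {P : Measure Ω}
    {a b : ℝ} {W Y : ℝ≥0 → Ω → ℝ} (hW : IsBrownianReal W P) (hY : IsLinearSDESolution a b W Y P) :
    ∀ᵐ ω ∂P, ∀ t : ℝ≥0, Real.exp (-a * t) * Y t ω = b * (Real.exp (-a * t) * W t ω -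
      ∫ s in (0 : ℝ)..t, W s.toNNReal ω * (-a * Real.exp (-a * s))) := by
  filter_upwards [hW.eval_zero_ae_eq_zero, hY.continuous_paths, hY.initial,
    hY.integral_eq] with ω hW0 hYc hY0 hint t
  have hyc : Continuous fun s : ℝ => Y s.toNNReal ω := hYc.comp continuous_real_toNNReal
  have := exp_neg_mul_eq_of_integral_eq (a := a) (b := b) (w := fun s => W s.toNNReal ω) hyc
    (fun s hs => by
      have := hint s.toNNReal
      rwa [hY0, hW0, zero_add, sub_zero, Real.coe_toNNReal _ hs] at this) t.coe_nonneg
  simpa only [Real.toNNReal_coe] using this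

section

variable {Ω : Type*} [MeasurableSpace Ω] {P : Measure Ω} [IsProbabilityMeasure P]

/-- The variance of the Wiener integral is `∫₀ᵗ e^{-2as} ds = (1 - e^{-2at}) / (2a)`, and the
squared diffusion coefficient `2a` cancels the denominator. -/
lemma IsLinearSDESolution.hasLaw_exp_neg_mul {a : ℝ} (ha : 0 < a) {W Y : ℝ≥0 → Ω → ℝ}
    (hW : IsBrownianReal W P) (hY : IsLinearSDESolution a (√(2 * a)) W Y P) (t : ℝ≥0) :
    HasLaw (fun ω => Real.exp (-a * t) * Y t ω)
      (gaussianReal 0 (1 - Real.exp (-(2 * a) * t)).toNNReal) P := by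
  have hE (s : ℝ) : HasDerivAt (fun s => Real.exp (-a * s)) (-a * Real.exp (-a * s)) s := by
    simpa [mul_comm] using ((hasDerivAt_id s).const_mul (-a)).exp
  have hE2 (s : ℝ) : HasDerivAt (fun s => -Real.exp (-(2 * a) * s) / (2 * a))
      (Real.exp (-a * s) ^ 2) s := by
    have h := ((((hasDerivAt_id s).const_mul (-(2 * a))).exp).neg).div_const (2 * a)
    refine h.congr_deriv ?_
    rw [← Real.exp_nat_mul]
    simp only [id, mul_one]
    field_simp
    congr 1
    push_cast
    ring
  have hvar : ∫ s in (0 : ℝ)..t, Real.exp (-a * s) ^ 2 =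
      (1 - Real.exp (-(2 * a) * t)) / (2 * a) := by
    rw [intervalIntegral.integral_eq_sub_of_hasDerivAt (fun s _ => hE2 s)
      (Continuous.intervalIntegrable (by fun_prop) _ _)]
    simp only [mul_zero, Real.exp_zero]
    ring
  have hlaw := gaussianReal_const_mul
    (IsBrownianReal.hasLaw_wienerIntegral hW hE (by fun_prop) t) (√(2 * a))
  have hle : Real.exp (-(2 * a) * t) ≤ 1 := Real.exp_le_one_iff.2 (by
    have := mul_nonneg (mul_pos two_pos ha).le t.coe_nonneg
    linarith [neg_mul (2 * a) (t : ℝ)])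
  have hv : NNReal.mk (√(2 * a) ^ 2) (sq_nonneg _) * (∫ s in (0 : ℝ)..t,
      Real.exp (-a * s) ^ 2).toNNReal = (1 - Real.exp (-(2 * a) * t)).toNNReal := by
    apply NNReal.eq
    rw [hvar, NNReal.coe_mul, Real.coe_toNNReal _ (by have := sub_nonneg.2 hle; positivity),
      Real.coe_toNNReal _ (sub_nonneg.2 hle), NNReal.coe_mk, Real.sq_sqrt (by positivity)]
    field_simp
  rw [mul_zero, hv] at hlaw
  refine hlaw.congr ?_
  filter_upwards [IsLinearSDESolution.exp_neg_mul_eq hW hY] with ω hω using hω t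

/-- The discounted solution converges to a standard Gaussian variable. -/
lemma IsLinearSDESolution.exists_tendsto_exp_neg_mul {a : ℝ} (ha : 0 < a) {W Y : ℝ≥0 → Ω → ℝ}
    (hW : IsBrownianReal W P) (hY : IsLinearSDESolution a (√(2 * a)) W Y P) :
    ∃ Z : Ω → ℝ, HasLaw Z (gaussianReal 0 1) P ∧
      ∀ᵐ ω ∂P, Tendsto (fun t : ℝ≥0 => Real.exp (-a * t) * Y t ω) atTop (𝓝 (Z ω)) := by
  have hlim : ∀ᵐ ω ∂P, Tendsto (fun t : ℝ≥0 => Real.exp (-a * t) * Y t ω) atTop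
      (𝓝 (√(2 * a) * -∫ s in Set.Ioi (0 : ℝ), W s.toNNReal ω * (-a * Real.exp (-a * s)))) := by
    filter_upwards [IsLinearSDESolution.exp_neg_mul_eq hW hY, hW.cont,
      IsBrownianReal.tendsto_div_atTop hW] with ω hω hc hdiv
    have hdiv' : Tendsto (fun s : ℝ => W s.toNNReal ω / s) atTop (𝓝 0) := by
      refine (hdiv.comp tendsto_real_toNNReal_atTop).congr' ?_
      filter_upwards [eventually_ge_atTop 0] with s hs
      simp [hs]
    have h := tendsto_exp_neg_mul_sub_integral ha
      (w := fun s => W s.toNNReal ω) (hc.comp continuous_real_toNNReal) hdiv'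
    refine ((h.comp (NNReal.tendsto_coe_atTop.2 tendsto_id)).const_mul _).congr fun t => ?_
    simp only [Function.comp_apply, id, Real.toNNReal_coe]
    exact (hω t).symm
  -- Integer times suffice to identify the law of the limit.
  refine ⟨_, hasLaw_gaussianReal_of_tendsto
    (fun n : ℕ => IsLinearSDESolution.hasLaw_exp_neg_mul ha hW hY n) ?_ ?_, hlim⟩
  · filter_upwards [hlim] with ω hω
    exact hω.comp tendsto_natCast_atTop_atTop
  · have h0 : Tendsto (fun n : ℕ => Real.exp (-(2 * a) * (n : ℝ))) atTop (𝓝 0) :=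
      Real.tendsto_exp_atBot.comp
        (tendsto_natCast_atTop_atTop.const_mul_atTop_of_neg (by linarith))
    simpa [Function.comp_def] using (continuous_real_toNNReal.tendsto _).comp (h0.const_sub 1)

/-- Because the limit is almost surely nonzero, the logarithm of the discounted solution stays
bounded for large times and vanishes after division by `T`; the discount factor contributes `a`. -/
lemma IsLinearSDESolution.tendsto_log_abs_div {a : ℝ} (ha : 0 < a) {W Y : ℝ≥0 → Ω → ℝ}
    (hW : IsBrownianReal W P) (hY : IsLinearSDESolution a (√(2 * a)) W Y P) :
    ∀ᵐ ω ∂P, Tendsto (fun T : ℝ≥0 => 1 / (T : ℝ) * Real.log |Y T ω|) atTop (𝓝 a) := by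
  obtain ⟨Z, hZ, hlim⟩ := IsLinearSDESolution.exists_tendsto_exp_neg_mul ha hW hY
  filter_upwards [hlim, ae_ne_zero_of_hasLaw_gaussianReal hZ one_ne_zero] with ω hω hZω
  have h1 : Tendsto (fun t : ℝ≥0 => Real.log |Real.exp (-a * t) * Y t ω|) atTop
      (𝓝 (Real.log |Z ω|)) := hω.abs.log (abs_ne_zero.2 hZω)
  have h2 : Tendsto (fun t : ℝ≥0 => 1 / (t : ℝ)) atTop (𝓝 0) :=
    tendsto_const_nhds.div_atTop (NNReal.tendsto_coe_atTop.2 tendsto_id)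
  have h3 := (h2.mul h1).add_const a
  rw [zero_mul, zero_add] at h3
  refine h3.congr' ?_
  filter_upwards [hω.eventually_ne hZω, eventually_gt_atTop 0] with t ht ht0
  have ht0' : (t : ℝ) ≠ 0 := by exact_mod_cast ht0.ne'
  rw [log_abs_exp_neg_mul a t ht]
  field_simp
  ring

/-- The offset `d` serves both normalisations at once: `0` for the uncentred variable and `logShift`
for the shifted one. -/
lemma IsLinearSDESolution.hasDerivAt_distributionFunction {a : ℝ} (ha : 0 < a)
    {W Y : ℝ≥0 → Ω → ℝ} (hW : IsBrownianReal W P)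
    (hY : IsLinearSDESolution a (√(2 * a)) W Y P) {T : ℝ≥0} (hT : 0 < T) {s : ℝ} (hs : 0 < s)
    (d x : ℝ) :
    HasDerivAt (distributionFunction P fun ω => (Real.log |Y T ω| + T * -a + d) / s)
      (2 * gaussianPDFReal 0 (1 - Real.exp (-(2 * a) * T)).toNNReal (Real.exp (s * x - d)) *
        (Real.exp (s * x - d) * s)) x := by
  have hlaw := IsLinearSDESolution.hasLaw_exp_neg_mul ha hW hY T
  have hv := one_sub_exp_toNNReal_ne_zero ha hT
  have heq : (distributionFunction P fun ω => (Real.log |Y T ω| + T * -a + d) / s) =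
      distributionFunction P fun ω => (Real.log |Real.exp (-a * T) * Y T ω| + d) / s := by
    funext y
    refine measureReal_congr ?_
    filter_upwards [ae_ne_zero_of_hasLaw_gaussianReal hlaw hv] with ω hω
    refine propext ?_
    change _ ≤ y ↔ _ ≤ y
    rw [log_abs_exp_neg_mul a T hω, mul_neg, ← sub_eq_add_neg]
  rw [heq]
  exact hasDerivAt_distributionFunction_log_abs hlaw hv hs d x

lemma IsLinearSDESolution.hasDensityFunction {a : ℝ} (ha : 0 < a)
    {W Y : ℝ≥0 → Ω → ℝ} (hW : IsBrownianReal W P)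
    (hY : IsLinearSDESolution a (√(2 * a)) W Y P) {T : ℝ≥0} (hT : 0 < T) {s : ℝ} (hs : 0 < s)
    (d : ℝ) : HasDensityFunction P fun ω => (Real.log |Y T ω| + T * -a + d) / s := by
  have := hY.aemeasurable T
  have hc := continuous_gaussianPDFReal 0 (1 - Real.exp (-(2 * a) * T)).toNNReal
  refine hasDensityFunction_of_hasDerivAt
    (f := fun x => 2 * gaussianPDFReal 0 (1 - Real.exp (-(2 * a) * T)).toNNReal
      (Real.exp (s * x - d)) * (Real.exp (s * x - d) * s)) (by fun_prop)
    (fun x => IsLinearSDESolution.hasDerivAt_distributionFunction ha hW hY hT hs d x)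
    (by fun_prop) fun x => ?_
  have := gaussianPDFReal_nonneg 0 (1 - Real.exp (-(2 * a) * T)).toNNReal (Real.exp (s * x - d))
  positivity

lemma IsLinearSDESolution.tendsto_densityFunction {a : ℝ} (ha : 0 < a)
    {W Y : ℝ≥0 → Ω → ℝ} (hW : IsBrownianReal W P)
    (hY : IsLinearSDESolution a (√(2 * a)) W Y P) (d x : ℝ) :
    Tendsto (fun T : ℝ≥0 =>
        densityFunction P (fun ω => (Real.log |Y T ω| + T * -a + d) / logScale) x)
      atTop (𝓝 (doublyExponentialDensity (x + (logShift - d) / logScale))) := by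
  have h0 : Tendsto (fun T : ℝ≥0 => Real.exp (-(2 * a) * (T : ℝ))) atTop (𝓝 0) :=
    Real.tendsto_exp_atBot.comp
      ((NNReal.tendsto_coe_atTop.2 tendsto_id).const_mul_atTop_of_neg (by linarith))
  have hv : Tendsto (fun T : ℝ≥0 => (1 - Real.exp (-(2 * a) * (T : ℝ))).toNNReal) atTop (𝓝 1) := by
    simpa [Function.comp_def] using (continuous_real_toNNReal.tendsto _).comp (h0.const_sub 1)
  -- Continuity is needed only at the limiting variance `1`, away from the degenerate variance `0`.
  have hpdf (y : ℝ) : ContinuousAt (fun v : ℝ≥0 => gaussianPDFReal 0 v y) 1 := by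
    unfold gaussianPDFReal
    refine ContinuousAt.mul (ContinuousAt.inv₀ (by fun_prop) ?_)
      (ContinuousAt.rexp (ContinuousAt.div (by fun_prop) (by fun_prop) (by norm_num)))
    have := Real.pi_pos
    simp only [NNReal.coe_one]
    positivity
  rw [← two_mul_gaussianPDFReal_mul_exp]
  refine ((((hpdf _).tendsto.comp hv).const_mul 2).mul_const _).congr' ?_
  filter_upwards [eventually_gt_atTop 0] with T hT
  exact (IsLinearSDESolution.hasDerivAt_distributionFunction ha hW hY hT logScale_pos d x).deriv.symm

end

theorem mainTheorem5 {Ω : Type*} [MeasurableSpace Ω] (P : Measure Ω) [IsProbabilityMeasure P]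
    (θ : ℝ) (hθ : θ < 0) (W Y : ℝ≥0 → Ω → ℝ) (hW : IsBrownianReal W P)
    (hY : IsLinearSDESolution (-θ) (√(-2 * θ)) W Y P) :
    (∀ᵐ ω ∂P, Tendsto (fun T : ℝ≥0 => 1 / (T : ℝ) * Real.log |Y T ω|) atTop (𝓝 (-θ))) ∧
    ((∀ T : ℝ≥0, 0 < T →
        HasDensityFunction P (fun ω => (Real.log |Y T ω| + T * θ) / logScale)) ∧
      ∀ x : ℝ, Tendsto
        (fun T : ℝ≥0 => densityFunction P (fun ω => (Real.log |Y T ω| + T * θ) / logScale) x)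
        atTop (𝓝 (doublyExponentialDensity (x + logShift / logScale)))) ∧
    ((∀ T : ℝ≥0, 0 < T →
        HasDensityFunction P (fun ω => (Real.log |Y T ω| + T * θ + logShift) / logScale)) ∧
      ∀ x : ℝ, Tendsto
        (fun T : ℝ≥0 =>
          densityFunction P (fun ω => (Real.log |Y T ω| + T * θ + logShift) / logScale) x)
        atTop (𝓝 (doublyExponentialDensity x))) := by
  have ha : 0 < -θ := neg_pos.2 hθ
  rw [show -2 * θ = 2 * -θ by ring] at hY
  refine ⟨IsLinearSDESolution.tendsto_log_abs_div ha hW hY, ⟨fun T hT => ?_, fun x => ?_⟩,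
    fun T hT => ?_, fun x => ?_⟩
  · simpa using IsLinearSDESolution.hasDensityFunction ha hW hY hT logScale_pos 0
  · simpa using IsLinearSDESolution.tendsto_densityFunction ha hW hY 0 x
  · simpa using IsLinearSDESolution.hasDensityFunction ha hW hY hT logScale_pos logShift
  · simpa using IsLinearSDESolution.tendsto_densityFunction ha hW hY logShift x
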